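/- Let $a_4,a_6\in\mathbb Z$ with $\Delta:=-16(4a_4^3+27a_6^2)\neq 0$, and let $E/\mathbb Q$ be the elliptic curve $y^2=x^3+a_4x+a_6$. For $P=(x,y)\in E(\mathbb Q)$ write $x=A/C^2$ with $A,C\in\mathbb Z$, $C\ne 0$, $\gcd(A,C)=1$, and put $h_W(P)=\log\max(|A|,C^2)$; put $h_W(\mathcal O)=0$ for the point at infinity $\mathcal O$. Let $\widehat h(P)=\tfrac12\lim_{n\to\infty}h_W(nP)/n^2$ (this limit exists), and let $\delta(E)=\max_{P\in E(\mathbb Q)}\left(\tfrac12h_W(P)-\widehat h(P)\right)$. For a prime $p$ let $E_0(\mathbb Q_p)\subset E(\mathbb Q_p)$ be the subgroup of points whose reduction modulo $p$, with respect to the given equation $y^2=x^3+a_4x+a_6$, is nonsingular, and let $c_p=|E(\mathbb Q_p)/E_0(\mathbb Q_p)|$. Suppose that $c_p=1$ for every prime $p$ at which the given equation has bad reduction, i.e. every prime $p\mid\Delta$ (in particular $p=2$), and that $a_4\le 0$. Then the following are true. (1) Suppose that $E(\mathbb R)$ has one connected component and that $2a_4x^2+8a_6x-a_4^2<0$ for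 all $x\in(\alpha,\infty)$, where $\alpha$ is the real root of $x^3+a_4x+a_6$. Then $\widehat h(P)\ge\tfrac12h_W(P)$ for every $P\in E(\mathbb Q)$, and $\delta(E)=0$. (2) Suppose that $E(\mathbb R)$ has two connected components and that $2a_4x^2+8a_6x-a_4^2<0$ for all $x\in(\gamma,\beta)\cup(\alpha,\infty)$, where $\gamma<\beta<\alpha$ are the real roots of $x^3+a_4x+a_6$. Then $\widehat h(P)\ge\tfrac12h_W(P)$ for every $P\in E(\mathbb Q)$, and $\delta(E)=0$. -/

import Mathlib

namespace EllHeight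

open Filter Topology

/-- The integral Weierstrass equation `y² = x³ + a₄ x + a₆`. -/
def curve (a₄ a₆ : ℤ) : WeierstrassCurve ℤ := ⟨0, 0, 0, a₄, a₆⟩

/-- The group `E(F)` of points (including the point at infinity) of `y² = x³ + a₄ x + a₆`
over a field `F`, with Mathlib's chord-and-tangent group law. -/
abbrev Pt (a₄ a₆ : ℤ) (F : Type) [Field F] : Type :=
  ((curve a₄ a₆).map (Int.castRingHom F)).toAffine.Point

/-- The logarithmic (Weil) height `h_W(P)`: it is `log max(|A|, D)` if `x(P) = A / D` in lowest
terms with `D > 0` (on `E` the denominator `D` is a square `C²`), and `0` at infinity. -/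
noncomputable def weilHeight {a₄ a₆ : ℤ} : Pt a₄ a₆ ℚ → ℝ
  | .zero => 0
  | .some x _ _ => Real.log (max |(x.num : ℝ)| (x.den : ℝ))

/-- The sequence `½ h_W(nP) / n²`, whose limit is the canonical height. -/
noncomputable def heightSeq {a₄ a₆ : ℤ} (P : Pt a₄ a₆ ℚ) (n : ℕ) : ℝ :=
  1 / 2 * (weilHeight (n • P) / (n : ℝ) ^ 2)

/-- The canonical height `ĥ(P) = ½ lim h_W(nP) / n²`. -/
noncomputable def canonicalHeight {a₄ a₆ : ℤ} (P : Pt a₄ a₆ ℚ) : ℝ :=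
  limUnder atTop (heightSeq P)

/-- The set of all values `½ h_W(P) - ĥ(P)`, for `P ∈ E(ℚ)`. -/
def heightDifferences (a₄ a₆ : ℤ) : Set ℝ :=
  Set.range fun P : Pt a₄ a₆ ℚ => 1 / 2 * weilHeight P - canonicalHeight P

/-- `δ(E)`, the supremum (the maximum, when it is attained) of `½ h_W(P) - ĥ(P)` over `E(ℚ)`. -/
noncomputable def delta (a₄ a₆ : ℤ) : ℝ := sSup (heightDifferences a₄ a₆)

/-- The point `P ∈ E(ℚ_p)` has nonsingular reduction, with respect to the given equation. The point
at infinity does, and so does an affine point with non-integral coordinates, because it reduces to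
the point at infinity. A point with integral coordinates does if and only if its coordinates modulo
`p` form a nonsingular point of the equation modulo `p`. (For a point of `E(ℚ_p)`, either both
coordinates are in `ℤ_p` or neither is.) -/
def NonsingularReduction {a₄ a₆ : ℤ} (p : ℕ) [Fact p.Prime] : Pt a₄ a₆ ℚ_[p] → Prop
  | .zero => True
  | .some x y _ => ∀ x₀ y₀ : ℤ_[p], (x₀ : ℚ_[p]) = x → (y₀ : ℚ_[p]) = y →
      ((curve a₄ a₆).map (Int.castRingHom (ZMod p))).toAffine.Nonsingular
        (PadicInt.toZMod x₀) (PadicInt.toZMod y₀)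

/-- `E₀(ℚ_p)`: the points of `E(ℚ_p)` whose reduction is nonsingular. -/
def E0 (a₄ a₆ : ℤ) (p : ℕ) [Fact p.Prime] : Set (Pt a₄ a₆ ℚ_[p]) :=
  {P | NonsingularReduction p P}

open scoped Classical in
/-- The Tamagawa number `c_p = |E(ℚ_p) / E₀(ℚ_p)|`: the number of cosets `P + E₀(ℚ_p)`
in `E(ℚ_p)`. -/
noncomputable def tamagawaNumber (a₄ a₆ : ℤ) (p : ℕ) [Fact p.Prime] : ℕ :=
  Nat.card {S : Set (Pt a₄ a₆ ℚ_[p]) // ∃ P, S = {Q | ∃ R ∈ E0 a₄ a₆ p, Q = P + R}}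

/-- The topology of `E(ℝ)` as a subspace of the real projective plane, the latter being
`ℝ³ ∖ {0}` modulo scaling with the quotient topology. -/
noncomputable abbrev realTopology (a₄ a₆ : ℤ) : TopologicalSpace (Pt a₄ a₆ ℝ) :=
  TopologicalSpace.induced
    (fun P => (WeierstrassCurve.Affine.Point.toProjective P).point)
    (inferInstanceAs (TopologicalSpace (Quotient (MulAction.orbitRel ℝˣ (Fin 3 → ℝ)))))

/-- The number of connected components of `E(ℝ)`. -/
noncomputable def numRealComponents (a₄ a₆ : ℤ) : ℕ :=
  letI := realTopology a₄ a₆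
  Nat.card (ConnectedComponents (Pt a₄ a₆ ℝ))

/-- `x` is a real root of `X³ + a₄ X + a₆`. -/
def IsRealRoot (a₄ a₆ : ℤ) (x : ℝ) : Prop := x ^ 3 + a₄ * x + a₆ = 0

/-- The set of real `x` with `2 a₄ x² + 8 a₆ x - a₄² < 0`. -/
def negSet (a₄ a₆ : ℤ) : Set ℝ :=
  {x : ℝ | 2 * (a₄ : ℝ) * x ^ 2 + 8 * (a₆ : ℝ) * x - (a₄ : ℝ) ^ 2 < 0}

/-- The canonical height exists (as a limit) and is at least half the Weil height at every
rational point, and the maximum `δ(E)` is attained and equals zero. -/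
def HeightConclusion (a₄ a₆ : ℤ) : Prop :=
  (∀ P : Pt a₄ a₆ ℚ, Tendsto (heightSeq P) atTop (𝓝 (canonicalHeight P)) ∧
    1 / 2 * weilHeight P ≤ canonicalHeight P) ∧
  IsGreatest (heightDifferences a₄ a₆) (delta a₄ a₆) ∧ delta a₄ a₆ = 0

end EllHeight

/-!
Why the statement holds. Write `x(P) = A / D` in lowest terms. Duplication gives `x(2P) = F / G`
with `F = A⁴ - 2 a A² D² - 8 b A D³ + a² D⁴` and `G = 4 D (A³ + a A D² + b D³)`. A prime dividing
both `F` and `G` would be a bad prime at which `P` has singular reduction, and the hypothesis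
`c_p = 1` says that there is no such point; so `F / G` is in lowest terms
(`coprime_dupNum_dupDen`) and `h_W(2P) = log max(|F|, |G|)`. It then suffices to have
`max(|F|, |G|) ≥ max(|A|, D)⁴`, for this gives `h_W(2P) ≥ 4 h_W(P)`, hence `ĥ(P) ≥ ½ h_W(P)`, with
equality at the point at infinity.

The inequality is one about the real number `x = x(P)`. For `|x| ≥ 1` it follows from the sign
condition `2 a x² + 8 b x - a² ≤ 0`. For `|x| < 1` it follows from the identity
`f + 2 x g = (3 x² + a)²`, where `f`, `g` are the dehomogenized `F`, `G`, and from `a` and `b` being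
integers, by inspecting a few small values (`max_pow_four_le_max_duplication`). Two curves resist:
* for `(a, b) = (-2, 1)` the point `(0, 1)` has singular reduction modulo `2`, so `c_2 ≠ 1`;
* for `(a, b) = (-2, -1)` the real inequality fails near `x = -0.8`, on the compact component of the
  real locus, but there are no rational points with `-1 < x < 0`, because a Fermat descent shows
  that `r⁴ - 3 r² e² + e⁴` is not a square for coprime nonzero `r`, `e` (`quartic_ne_sq`).

The sign condition is assumed only on part of the line. If there are three real roots `γ < β < α`,
then it covers, up to closure, the set where the cubic is nonnegative. In the case of one component,
connectedness of `E(ℝ)` is used to see that no real point lies to the left of the given root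
(`cubic_nonneg_of_numRealComponents_eq_one`).

The limit defining `ĥ` exists because `h_W` satisfies the parallelogram law up to a constant. This
follows from Mathlib's height estimate for `WeierstrassCurve.addSubMap`, once that map is identified
with `{x(P), x(Q)} ↦ {x(P + Q), x(P - Q)}` (`exists_eval_addSubMap_eq_smul`). Then
`h_W(k n P) - k² h_W(n P) = O(k²)` uniformly in `n`, so that `h_W(n P) / n²` is a Cauchy sequence.
-/

namespace EllHeight

open WeierstrassCurve Filter Topology

/-! ### Points of the curve -/

lemma curve_Δ (a b : ℤ) : (curve a b).Δ = -16 * (4 * a ^ 3 + 27 * b ^ 2) := by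
  simp [WeierstrassCurve.Δ, WeierstrassCurve.b₂, WeierstrassCurve.b₄, WeierstrassCurve.b₆,
    WeierstrassCurve.b₈, curve]
  ring

lemma curve_equation_iff {a b : ℤ} {F : Type} [CommRing F] {x y : F} :
    ((curve a b).map (Int.castRingHom F)).toAffine.Equation x y ↔ y ^ 2 = x ^ 3 + a * x + b := by
  simp [Affine.equation_iff, curve]

lemma isElliptic_curve_map {a b : ℤ} (hE : (curve a b).Δ ≠ 0) (F : Type) [Field F] [CharZero F] :
    ((curve a b).map (Int.castRingHom F)).IsElliptic := by
  refine ⟨?_⟩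
  rw [map_Δ, isUnit_iff_ne_zero]
  simpa using hE

/-- The affine point `(x, y)` of a curve of nonzero discriminant. -/
def mkPt {a b : ℤ} (hE : (curve a b).Δ ≠ 0) {F : Type} [Field F] [CharZero F] {x y : F}
    (h : y ^ 2 = x ^ 3 + a * x + b) : Pt a b F :=
  .some x y (haveI := isElliptic_curve_map hE F
    Affine.equation_iff_nonsingular.mp (curve_equation_iff.mpr h))

/-! ### The real locus of a connected curve -/

/-- A representative in `ℝ³` of the projective point attached to a point of `E(ℝ)`. -/
def homCoords {a b : ℤ} : Pt a b ℝ → Fin 3 → ℝ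
  | .zero => ![0, 1, 0]
  | .some x y _ => ![x, y, 1]

lemma toProjective_point_eq {a b : ℤ} (P : Pt a b ℝ) :
    (Affine.Point.toProjective P).point = ⟦homCoords P⟧ := by
  cases P <;> rfl

lemma isOpen_setOf_homCoords_mem {a b : ℤ} {V : Set (Fin 3 → ℝ)} (hV : IsOpen V)
    (hsmul : ∀ (u : ℝˣ) (v : Fin 3 → ℝ), u • v ∈ V → v ∈ V) :
    IsOpen[realTopology a b] {P | homCoords P ∈ V} := by
  refine ⟨Quotient.mk (MulAction.orbitRel ℝˣ (Fin 3 → ℝ)) '' V, ?_, ?_⟩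
  · exact isOpenMap_quotient_mk'_mul V hV
  · ext P
    rw [Set.mem_preimage, toProjective_point_eq]
    constructor
    · rintro ⟨v, hv, h⟩
      obtain ⟨u, rfl⟩ := Quotient.exact h
      exact hsmul u _ hv
    · exact fun h => ⟨_, h, rfl⟩

/-- If `E(ℝ)` is connected, then the cubic cannot become negative to the right of a point of the
real locus: a point `m` with a negative value would separate `{x < m}` from `{x > m} ∪ {O}`. -/
theorem cubic_nonneg_of_numRealComponents_eq_one {a b : ℤ} (hE : (curve a b).Δ ≠ 0)
    (hconn : numRealComponents a b = 1) {x₁ m : ℝ} (hlt : x₁ < m)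
    (hx₁ : 0 ≤ x₁ ^ 3 + a * x₁ + b) : 0 ≤ m ^ 3 + a * m + b := by
  by_contra! hm
  -- on the part of the curve to the left of `m`, the ordinate is bounded
  obtain ⟨K, hK⟩ : ∃ K : ℝ, ∀ x y : ℝ, x < m → y ^ 2 = x ^ 3 + a * x + b → |y| ≤ K := by
    have hcont : ContinuousOn (fun x : ℝ => x ^ 3 + a * x + b)
      (Set.Icc (-(1 + |(a : ℝ)| + |(b : ℝ)|)) m) := by fun_prop
    obtain ⟨M, hM⟩ := isCompact_Icc.exists_bound_of_continuousOn hcont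
    refine ⟨M + 1, fun x y hx hy => ?_⟩
    have hxR : -(1 + |(a : ℝ)| + |(b : ℝ)|) ≤ x := by
      by_contra! h
      have h1 : 1 + |(a : ℝ)| + |(b : ℝ)| < -x := by linarith
      have ha := abs_nonneg (a : ℝ)
      have hb := abs_nonneg (b : ℝ)
      have ha' := neg_abs_le (a : ℝ)
      have hb' := le_abs_self (b : ℝ)
      have h2 : 1 + |(a : ℝ)| + |(b : ℝ)| < (-x) ^ 2 := by nlinarith
      have h3 : (1 + |(a : ℝ)| + |(b : ℝ)|) * (-x) < (-x) ^ 2 * (-x) := by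
        apply mul_lt_mul_of_pos_right h2; linarith
      nlinarith [sq_nonneg y, mul_nonneg hb (by linarith : 0 ≤ -x - 1),
        mul_nonneg (by linarith : 0 ≤ |(a : ℝ)| + a) (by linarith : 0 ≤ -x)]
    have h1 := (le_abs_self _).trans (hM x ⟨hxR, hx.le⟩)
    rw [← hy] at h1
    have h2 : |y| ^ 2 ≤ M := by rwa [sq_abs]
    nlinarith [sq_nonneg (|y| - 1)]
  let _ := realTopology a b
  -- homogeneous forms of `{x > m}` together with a neighbourhood of infinity, and of `{x < m}`
  let V : Set (Fin 3 → ℝ) := {v | 0 < v 2 * (v 0 - m * v 2)} ∪ {v | K * |v 2| < |v 1|}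
  let W : Set (Fin 3 → ℝ) := {v | v 2 * (v 0 - m * v 2) < 0}
  have hVo : IsOpen V :=
    (isOpen_lt (by fun_prop) (by fun_prop)).union (isOpen_lt (by fun_prop) (by fun_prop))
  have hWo : IsOpen W := isOpen_lt (by fun_prop) (by fun_prop)
  have hq (u : ℝˣ) (v : Fin 3 → ℝ) : (u • v) 2 * ((u • v) 0 - m * (u • v) 2) =
      (u : ℝ) ^ 2 * (v 2 * (v 0 - m * v 2)) := by
    simp only [Pi.smul_apply, Units.smul_def, smul_eq_mul]; ring
  have hupos (u : ℝˣ) : (0 : ℝ) < (u : ℝ) ^ 2 := by have := u.ne_zero; positivity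
  have hV := isOpen_setOf_homCoords_mem (a := a) (b := b) hVo fun u v hv => by
    rcases hv with hv | hv
    · left
      rw [Set.mem_ofPred_eq, hq] at hv
      exact pos_of_mul_pos_right hv (hupos u).le
    · right
      simp only [Set.mem_ofPred_eq, Pi.smul_apply, Units.smul_def, smul_eq_mul, abs_mul] at hv ⊢
      have : |(u : ℝ)| * (K * |v 2|) < |(u : ℝ)| * |v 1| := by linarith
      exact lt_of_mul_lt_mul_left this (abs_nonneg _)
  have hW := isOpen_setOf_homCoords_mem (a := a) (b := b) hWo fun u v hv => by
    change (u • v) 2 * ((u • v) 0 - m * (u • v) 2) < 0 at hv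
    rw [hq] at hv
    exact neg_of_mul_neg_right hv (hupos u).le
  have hcompl : {P : Pt a b ℝ | homCoords P ∈ W} = {P | homCoords P ∈ V}ᶜ := by
    ext P
    cases P with
    | zero => simp [homCoords, V, W]
    | some x y h =>
      have hy := curve_equation_iff.mp h.1
      have hxm : x ≠ m := by
        rintro rfl
        nlinarith [sq_nonneg y]
      simp only [homCoords, V, W, Set.mem_ofPred_eq, Set.mem_compl_iff, Set.mem_union,
        Matrix.cons_val, mul_one, one_mul, abs_one, sub_neg, sub_pos, not_or, not_lt]
      exact ⟨fun h => ⟨h.le, hK x y h hy⟩, fun h => lt_of_le_of_ne h.1 hxm⟩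
  have hclopen : IsClopen {P : Pt a b ℝ | homCoords P ∈ V} :=
    ⟨⟨hcompl ▸ hW⟩, hV⟩
  let P₁ : Pt a b ℝ := mkPt hE (Real.sq_sqrt hx₁)
  have hsub : Subsingleton (ConnectedComponents (Pt a b ℝ)) :=
    (Nat.card_eq_one_iff_unique.mp hconn).1
  have hmem : P₁ ∈ connectedComponent (0 : Pt a b ℝ) :=
    ConnectedComponents.coe_eq_coe'.mp (Subsingleton.elim _ _)
  have h0 : (0 : Pt a b ℝ) ∈ {P : Pt a b ℝ | homCoords P ∈ V} :=
    Or.inr (by simp [homCoords])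
  have h1 : P₁ ∈ {P : Pt a b ℝ | homCoords P ∈ W} := by
    simpa [P₁, mkPt, homCoords, W] using hlt
  rw [hcompl] at h1
  exact h1 (hclopen.connectedComponent_subset h0 hmem)

/-! ### Reduction modulo primes and the duplication formula -/

lemma nonsingularReduction_of_tamagawaNumber_eq_one {a b : ℤ} {p : ℕ} [Fact p.Prime]
    (h : tamagawaNumber a b p = 1) (P : Pt a b ℚ_[p]) : NonsingularReduction p P := by
  classical
  have hsub := (Nat.card_eq_one_iff_unique.mp h).1
  have h0 : (0 : Pt a b ℚ_[p]) ∈ E0 a b p := trivial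
  have heq := congrArg Subtype.val (hsub.elim ⟨_, P, rfl⟩ ⟨_, 0, rfl⟩)
  have hP : P ∈ {Q | ∃ R ∈ E0 a b p, Q = P + R} := ⟨0, h0, (add_zero P).symm⟩
  simp only at heq
  rw [heq] at hP
  obtain ⟨R, hR, hPR⟩ := hP
  rw [zero_add] at hPR
  rwa [hPR]

/-- The homogenized numerator of the duplication map on `x`-coordinates. -/
def dupNum (a b A D : ℤ) : ℤ := A ^ 4 - 2 * a * A ^ 2 * D ^ 2 - 8 * b * A * D ^ 3 + a ^ 2 * D ^ 4

/-- The homogenized denominator of the duplication map on `x`-coordinates. -/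
def dupDen (a b A D : ℤ) : ℤ := 4 * D * (A ^ 3 + a * A * D ^ 2 + b * D ^ 3)

/-- If no rational point has singular reduction, there is no cancellation in the duplication
formula: a common prime factor `p` of numerator and denominator would force `2 y = 0` and
`3 x² + a = 0` modulo `p`. -/
theorem coprime_dupNum_dupDen {a b : ℤ} (hE : (curve a b).Δ ≠ 0)
    (hc : ∀ (p : ℕ) [Fact p.Prime], (p : ℤ) ∣ (curve a b).Δ → tamagawaNumber a b p = 1)
    {x y : ℚ} (hxy : y ^ 2 = x ^ 3 + a * x + b) :
    (dupNum a b x.num x.den).natAbs.Coprime (dupDen a b x.num x.den).natAbs := by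
  by_contra hnot
  obtain ⟨p, hp, hpF, hpG⟩ := Nat.Prime.not_coprime_iff_dvd.mp hnot
  have : Fact p.Prime := ⟨hp⟩
  rw [← Int.natCast_dvd] at hpF hpG
  have hpD : ¬ p ∣ x.den := by
    intro hD
    have hD' : (p : ℤ) ∣ x.den := by exact_mod_cast hD
    have hA : (p : ℤ) ∣ x.num ^ 4 := by
      have e : x.num ^ 4 = dupNum a b x.num x.den - x.den *
          (-2 * a * x.num ^ 2 * x.den - 8 * b * x.num * x.den ^ 2 + a ^ 2 * x.den ^ 3) := by
        unfold dupNum; ring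
      rw [e]
      exact dvd_sub hpF (hD'.mul_right _)
    have hA' := Int.natCast_dvd.mp ((Nat.prime_iff_prime_int.mp hp).dvd_of_dvd_pow hA)
    exact hp.one_lt.ne' (Nat.dvd_one.mp (x.reduced ▸ Nat.dvd_gcd hA' hD))
  have hxy' : (y : ℚ_[p]) ^ 2 = (x : ℚ_[p]) ^ 3 + a * (x : ℚ_[p]) + b := by exact_mod_cast hxy
  obtain ⟨x₀, hx₀⟩ : ∃ x₀ : ℤ_[p], (x₀ : ℚ_[p]) = x := ⟨⟨_, Padic.norm_rat_le_one hpD⟩, rfl⟩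
  obtain ⟨y₀, hy₀⟩ : ∃ y₀ : ℤ_[p], (y₀ : ℚ_[p]) = y := by
    refine ⟨⟨_, ?_⟩, rfl⟩
    have h1 : ‖(y : ℚ_[p])‖ ^ 2 ≤ 1 := by
      rw [← norm_pow, hxy', ← hx₀]
      have := PadicInt.norm_le_one (x₀ ^ 3 + (a : ℤ_[p]) * x₀ + (b : ℤ_[p]))
      rw [PadicInt.norm_def] at this
      exact_mod_cast this
    exact (pow_le_one_iff_of_nonneg (norm_nonneg _) two_ne_zero).mp h1
  have hcurve₀ : y₀ ^ 2 = x₀ ^ 3 + a * x₀ + b := by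
    apply PadicInt.ext
    push_cast
    rw [hx₀, hy₀, hxy']
  have hxD₀ : x₀ * (x.den : ℤ_[p]) = x.num := by
    apply PadicInt.ext
    push_cast
    rw [hx₀]
    exact_mod_cast congrArg (Rat.cast : ℚ → ℚ_[p]) (Rat.mul_den_eq_num x)
  obtain ⟨z, hz⟩ : ∃ z, PadicInt.toZMod x₀ = z := ⟨_, rfl⟩
  obtain ⟨w, hw⟩ : ∃ w, PadicInt.toZMod y₀ = w := ⟨_, rfl⟩
  have hcurve : w ^ 2 = z ^ 3 + a * z + b := by
    have := congrArg PadicInt.toZMod hcurve₀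
    simpa [hz, hw] using this
  have hxD : z * (x.den : ZMod p) = x.num := by
    have := congrArg PadicInt.toZMod hxD₀
    simpa [hz, hw] using this
  have hD0 : (x.den : ZMod p) ≠ 0 := by rwa [Ne, ZMod.natCast_eq_zero_iff]
  have hF : z ^ 4 - 2 * a * z ^ 2 - 8 * b * z + a ^ 2 = 0 := by
    have := (ZMod.intCast_zmod_eq_zero_iff_dvd _ p).mpr hpF
    simp only [dupNum, Int.cast_sub, Int.cast_add, Int.cast_mul, Int.cast_pow, Int.cast_natCast,
      Int.cast_ofNat, ← hxD] at this
    apply (mul_eq_zero.mp _).resolve_left (pow_ne_zero 4 hD0)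
    linear_combination this
  have hG : 4 * (z ^ 3 + a * z + b) = 0 := by
    have := (ZMod.intCast_zmod_eq_zero_iff_dvd _ p).mpr hpG
    simp only [dupDen, Int.cast_add, Int.cast_mul, Int.cast_pow, Int.cast_natCast,
      Int.cast_ofNat, ← hxD] at this
    apply (mul_eq_zero.mp _).resolve_left (pow_ne_zero 4 hD0)
    linear_combination this
  -- the numerator plus `2 z` times the denominator is the square of the derivative of the cubic
  have hder : 3 * z ^ 2 + a = 0 := by
    apply pow_eq_zero_iff two_ne_zero |>.mp
    linear_combination hF + 2 * z * hG
  have h2w : 2 * w = 0 := by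
    apply pow_eq_zero_iff two_ne_zero |>.mp
    linear_combination 4 * hcurve + hG
  have hΔ : (p : ℤ) ∣ (curve a b).Δ := by
    rw [← ZMod.intCast_zmod_eq_zero_iff_dvd, curve_Δ]
    push_cast
    have ha : (a : ZMod p) = -3 * z ^ 2 := by linear_combination hder
    have hb : 4 * (b : ZMod p) = 8 * z ^ 3 := by linear_combination hG - 4 * z * hder
    rw [ha]
    linear_combination (-27 * (4 * (b : ZMod p) + 8 * z ^ 3)) * hb
  have hns := nonsingularReduction_of_tamagawaNumber_eq_one (hc p hΔ) (mkPt hE hxy') x₀ y₀ hx₀ hy₀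
  rw [hz, hw] at hns
  rcases ((Affine.nonsingular_iff _ _).mp hns).2 with h | h
  · apply h
    simp [curve, hder]
  · apply h
    simp only [curve, map_a₁, map_a₃, map_zero]
    linear_combination h2w

/-- The point `(0, 1)` of `y² = x³ - 2 x + 1` has singular reduction modulo `2`. -/
lemma tamagawaNumber_neg_two_one_ne_one : tamagawaNumber (-2) 1 2 ≠ 1 := by
  intro h
  have hE : (curve (-2) 1).Δ ≠ 0 := by rw [curve_Δ]; norm_num
  have hxy : (1 : ℚ_[2]) ^ 2 = 0 ^ 3 + ((-2 : ℤ) : ℚ_[2]) * 0 + ((1 : ℤ) : ℚ_[2]) := by simp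
  have hns := nonsingularReduction_of_tamagawaNumber_eq_one h (mkPt hE hxy) 0 1 (by simp) (by simp)
  have h2 : (2 : ZMod 2) = 0 := by decide
  rcases ((Affine.nonsingular_iff _ _).mp hns).2 with h | h
  · apply h
    simp [curve, h2]
  · apply h
    simp [curve]

/-! ### The parallelogram law up to a constant -/

lemma eval_addSubMap {a b : ℤ} (v : Fin 3 → ℚ) :
    (fun i => (addSubMap ((curve a b).map (Int.castRingHom ℚ)) i).eval v) =
      ![v 0 ^ 2 - 2 * a * v 0 * v 2 - 4 * b * v 1 * v 2 + a ^ 2 * v 2 ^ 2,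
        2 * v 1 * v 0 + 2 * a * v 1 * v 2 + 4 * b * v 2 ^ 2,
        v 1 ^ 2 - 4 * v 0 * v 2] := by
  ext i
  fin_cases i <;>
    simp [addSubMap, curve, WeierstrassCurve.b₂, WeierstrassCurve.b₄, WeierstrassCurve.b₆,
      WeierstrassCurve.b₈]

lemma negY_curve {a b : ℤ} {x y : ℚ} :
    ((curve a b).map (Int.castRingHom ℚ)).toAffine.negY x y = -y := by
  simp [Affine.negY, curve]

/-- Duplication formula for the `x`-coordinate, away from the `2`-torsion. -/
lemma xRep_add_self {a b : ℤ} {x y : ℚ}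
    (h : ((curve a b).map (Int.castRingHom ℚ)).toAffine.Nonsingular x y) (hy : y ≠ 0) :
    (Affine.Point.some x y h + Affine.Point.some x y h : Pt a b ℚ).xRep =
      ![(x ^ 4 - 2 * a * x ^ 2 - 8 * b * x + a ^ 2) / (4 * (x ^ 3 + a * x + b)), 1] := by
  have hy' : y ≠ ((curve a b).map (Int.castRingHom ℚ)).toAffine.negY x y := by
    rw [negY_curve]
    intro h
    exact hy (by linarith)
  have heq := curve_equation_iff.mp h.1
  rw [Affine.Point.add_self_of_Y_ne hy', Affine.Point.xRep_some, Affine.slope_of_Y_ne rfl hy',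
    negY_curve]
  congr 1
  simp only [Affine.addX, curve, map_a₁, map_a₂, map_a₄, map_zero, Int.coe_castRingHom]
  rw [← heq]
  field_simp
  linear_combination (-32 * x) * heq

lemma add_self_eq_zero {a b : ℤ} {x y : ℚ}
    (h : ((curve a b).map (Int.castRingHom ℚ)).toAffine.Nonsingular x y) (hy : y = 0) :
    (Affine.Point.some x y h + Affine.Point.some x y h : Pt a b ℚ) = 0 := by
  refine Affine.Point.add_self_of_Y_eq ?_
  rw [negY_curve, hy, neg_zero]

lemma xRep_add_of_X_ne {a b : ℤ} {x₁ y₁ x₂ y₂ : ℚ}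
    (h₁ : ((curve a b).map (Int.castRingHom ℚ)).toAffine.Nonsingular x₁ y₁)
    (h₂ : ((curve a b).map (Int.castRingHom ℚ)).toAffine.Nonsingular x₂ y₂) (hx : x₁ ≠ x₂) :
    (Affine.Point.some x₁ y₁ h₁ + Affine.Point.some x₂ y₂ h₂ : Pt a b ℚ).xRep =
      ![((y₁ - y₂) / (x₁ - x₂)) ^ 2 - x₁ - x₂, 1] := by
  rw [Affine.Point.add_of_X_ne hx, Affine.Point.xRep_some, Affine.slope_of_X_ne hx]
  simp [Affine.addX, curve]

/-- `addSubMap` computes the pair `{x(P + Q), x(P - Q)}` from the pair `{x(P), x(Q)}`, up to a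
projective factor. -/
theorem exists_eval_addSubMap_eq_smul {a b : ℤ} (hE : (curve a b).Δ ≠ 0) (P Q : Pt a b ℚ) :
    ∃ t : ℚ, t ≠ 0 ∧
      (fun i => (addSubMap ((curve a b).map (Int.castRingHom ℚ)) i).eval (P.sym2x Q)) =
        t • (P + Q).sym2x (P - Q) := by
  have := isElliptic_curve_map hE ℚ
  -- the diagonal case
  have hself (x y : ℚ) (h : ((curve a b).map (Int.castRingHom ℚ)).toAffine.Nonsingular x y) :
      ∃ t : ℚ, t ≠ 0 ∧ (fun i => (addSubMap ((curve a b).map (Int.castRingHom ℚ)) i).eval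
        ((Affine.Point.some x y h : Pt a b ℚ).sym2x (.some x y h))) =
        t • (Affine.Point.some x y h + .some x y h : Pt a b ℚ).sym2x 0 := by
    have heq := curve_equation_iff.mp h.1
    by_cases hy : y = 0
    · have hne := addSubMap_ne_zero ((curve a b).map (Int.castRingHom ℚ))
        (Affine.Point.sym2x_ne_zero (.some x y h) (.some x y h))
      rw [add_self_eq_zero h hy, Affine.Point.sym2x_zero_zero]
      have hg : x ^ 3 + a * x + b = 0 := by rw [← heq, hy]; ring
      have hv : (fun i => (addSubMap ((curve a b).map (Int.castRingHom ℚ)) i).eval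
          ((Affine.Point.some x y h : Pt a b ℚ).sym2x (.some x y h))) =
          (x ^ 4 - 2 * a * x ^ 2 - 8 * b * x + a ^ 2) • ![1, 0, 0] := by
        rw [eval_addSubMap, Affine.Point.sym2x_some_some]
        ext i
        fin_cases i <;> simp
        · ring
        · linear_combination 4 * hg
        · ring
      refine ⟨_, ?_, hv⟩
      intro h0
      rw [hv, h0, zero_smul] at hne
      exact hne rfl
    · refine ⟨4 * (x ^ 3 + a * x + b), by rw [← heq]; positivity, ?_⟩
      have hne : x ^ 3 + a * x + b ≠ 0 := by rw [← heq]; positivity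
      rw [eval_addSubMap, Affine.Point.sym2x_some_some, Affine.Point.sym2x, xRep_add_self h hy,
        Affine.Point.xRep_zero]
      ext i
      fin_cases i <;> simp
      · rw [mul_div_cancel₀ _ (mul_ne_zero four_ne_zero hne)]
        ring
      · ring
      · ring
  rcases P with _ | ⟨x₁, y₁, h₁⟩
  · refine ⟨1, one_ne_zero, ?_⟩
    rw [← Affine.Point.zero_def, zero_add, zero_sub, Affine.Point.sym2x_neg_right, eval_addSubMap,
      one_smul]
    rcases Q with _ | ⟨x₂, y₂, h₂⟩
    · rw [← Affine.Point.zero_def, Affine.Point.sym2x_zero_zero]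
      ext i
      fin_cases i <;> simp
    · rw [Affine.Point.sym2x_zero_some, Affine.Point.sym2x_some_some]
      ext i
      fin_cases i <;> simp <;> ring
  rcases Q with _ | ⟨x₂, y₂, h₂⟩
  · refine ⟨1, one_ne_zero, ?_⟩
    rw [← Affine.Point.zero_def, add_zero, sub_zero, eval_addSubMap, one_smul,
      Affine.Point.sym2x_some_zero, Affine.Point.sym2x_some_some]
    ext i
    fin_cases i <;> simp <;> ring
  by_cases hx : x₁ = x₂
  · have hcase : (Affine.Point.some x₁ y₁ h₁ : Pt a b ℚ) = .some x₂ y₂ h₂ ∨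
        (Affine.Point.some x₁ y₁ h₁ : Pt a b ℚ) = -.some x₂ y₂ h₂ := by
      apply Affine.Point.eq_or_eq_neg_of_xRep_eq_xRep
      rw [Affine.Point.xRep_some, Affine.Point.xRep_some, hx]
    rcases hcase with h | h
    · rw [h, sub_self]
      exact hself x₂ y₂ h₂
    · rw [h, neg_add_cancel, ← neg_add', Affine.Point.sym2x_neg_left, Affine.Point.sym2x_neg_right,
        Affine.Point.sym2x_comm 0]
      exact hself x₂ y₂ h₂
  · have e₁ := curve_equation_iff.mp h₁.1
    have e₂ := curve_equation_iff.mp h₂.1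
    have hx' : x₁ - x₂ ≠ 0 := sub_ne_zero.mpr hx
    refine ⟨(x₁ - x₂) ^ 2, pow_ne_zero 2 hx', ?_⟩
    rw [eval_addSubMap, Affine.Point.sym2x_some_some, sub_eq_add_neg (G := Pt a b ℚ),
      Affine.Point.neg_some, Affine.Point.sym2x, xRep_add_of_X_ne h₁ h₂ hx,
      xRep_add_of_X_ne h₁ _ hx, negY_curve]
    have hb : (b : ℚ) = y₁ ^ 2 - x₁ ^ 3 - a * x₁ := by linear_combination -e₁
    have ha : (a : ℚ) = (y₁ ^ 2 - y₂ ^ 2 - x₁ ^ 3 + x₂ ^ 3) / (x₁ - x₂) := by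
      rw [eq_div_iff hx']
      linear_combination e₂ - e₁
    rw [hb, ha]
    ext i
    fin_cases i <;> simp <;> field_simp <;> ring

@[simp]
lemma weilHeight_zero {a b : ℤ} : weilHeight (0 : Pt a b ℚ) = 0 := rfl

lemma logHeight_xRep {a b : ℤ} (P : Pt a b ℚ) : Height.logHeight P.xRep = weilHeight P := by
  rcases P with _ | ⟨x, y, h⟩
  · rw [← Affine.Point.zero_def, Affine.Point.xRep_zero, Height.logHeight_swap,
      ← Height.logHeight₁_eq_logHeight, Height.logHeight₁_zero]
    rfl
  · rw [Affine.Point.xRep_some, ← Height.logHeight₁_eq_logHeight, Rat.logHeight₁_eq_log_max]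
    simp [weilHeight, Nat.cast_natAbs]

/-- The approximate parallelogram law. -/
theorem exists_parallelogram_bound {a b : ℤ} (hE : (curve a b).Δ ≠ 0) :
    ∃ C : ℝ, ∀ P Q : Pt a b ℚ,
      |weilHeight (P + Q) + weilHeight (P - Q) - 2 * weilHeight P - 2 * weilHeight Q| ≤ C := by
  have := isElliptic_curve_map hE ℚ
  obtain ⟨C₁, hC₁⟩ := abs_logHeight_addSubMap_sub_two_mul_logHeight_le
    ((curve a b).map (Int.castRingHom ℚ))
  obtain ⟨C₂, hC₂⟩ := Height.abs_logHeight_sym2_sub_le ℚ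
  have hsym (P Q : Pt a b ℚ) :
      |Height.logHeight (P.sym2x Q) - (weilHeight P + weilHeight Q)| ≤ C₂ := by
    have he (R : Pt a b ℚ) : ![R.xRep 0, R.xRep 1] = R.xRep := by
      ext i; fin_cases i <;> rfl
    have hne (R : Pt a b ℚ) : ![R.xRep 0, R.xRep 1] ≠ 0 := by
      rw [he]; exact R.xRep_ne_zero
    have := hC₂ (hne P) (hne Q)
    rwa [he, he, logHeight_xRep, logHeight_xRep] at this
  refine ⟨3 * C₂ + C₁, fun P Q => ?_⟩
  obtain ⟨t, ht, h⟩ := exists_eval_addSubMap_eq_smul hE P Q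
  have h1 := hC₁ (P.sym2x Q)
  rw [h, Height.logHeight_smul_eq_logHeight _ ht] at h1
  have h2 := hsym P Q
  have h3 := hsym (P + Q) (P - Q)
  rw [abs_le] at h1 h2 h3 ⊢
  constructor <;> linarith

/-! ### Sequences that are quadratic up to a bounded error -/

/-- A sequence obeying the parallelogram law up to `C` is quadratic along multiples, with an
error that is quadratic in the multiplier and uniform in the base. -/
lemma abs_sub_sq_mul_le {a : ℕ → ℝ} {C : ℝ} (h0 : a 0 = 0)
    (h : ∀ m n, n ≤ m → |a (m + n) + a (m - n) - 2 * a m - 2 * a n| ≤ C) (k n : ℕ) :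
    |a (k * n) - k ^ 2 * a n| ≤ C * k ^ 2 / 2 := by
  suffices |a (k * n) - k ^ 2 * a n| ≤ C * k ^ 2 / 2 ∧
      |(a ((k + 1) * n) - (k + 1) ^ 2 * a n) - (a (k * n) - k ^ 2 * a n)| ≤ C * k from this.1
  induction k with
  | zero => simp [h0]
  | succ k ih =>
    obtain ⟨ih₁, ih₂⟩ := ih
    have hC : 0 ≤ C := (abs_nonneg _).trans (h 0 0 le_rfl)
    have key := h ((k + 1) * n) n (Nat.le_mul_of_pos_left n k.succ_pos)
    rw [show (k + 1) * n + n = (k + 1 + 1) * n by ring,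
      show (k + 1) * n - n = k * n by rw [add_mul, one_mul, Nat.add_sub_cancel]] at key
    rw [abs_le] at ih₁ ih₂ key
    push_cast
    constructor <;> rw [abs_le] <;> constructor <;> nlinarith

/-- Such a sequence, divided by `n²`, converges. -/
theorem exists_tendsto_div_sq {a : ℕ → ℝ} {C : ℝ} (h0 : a 0 = 0)
    (h : ∀ m n, n ≤ m → |a (m + n) + a (m - n) - 2 * a m - 2 * a n| ≤ C) :
    ∃ l, Tendsto (fun n : ℕ => a n / (n : ℝ) ^ 2) atTop (𝓝 l) := by
  have hC : 0 ≤ C := (abs_nonneg _).trans (h 0 0 le_rfl)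
  have hmul (k n : ℕ) (hk : 0 < k) (hn : 0 < n) :
      |a (k * n) / ((k * n : ℕ) : ℝ) ^ 2 - a n / (n : ℝ) ^ 2| ≤ C / n ^ 2 := by
    have hk' : (0 : ℝ) < k := by exact_mod_cast hk
    have hn' : (0 : ℝ) < n := by exact_mod_cast hn
    have e : a (k * n) / ((k * n : ℕ) : ℝ) ^ 2 - a n / (n : ℝ) ^ 2 =
        (a (k * n) - k ^ 2 * a n) / (k ^ 2 * n ^ 2) := by
      push_cast; field_simp
    rw [e, abs_div, abs_of_pos (by positivity : (0 : ℝ) < k ^ 2 * n ^ 2), div_le_div_iff₀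
      (by positivity) (by positivity)]
    have := abs_sub_sq_mul_le h0 h k n
    calc _ ≤ C * k ^ 2 / 2 * (n : ℝ) ^ 2 := by gcongr
      _ ≤ _ := by nlinarith [mul_nonneg hC (by positivity : (0 : ℝ) ≤ (k : ℝ) ^ 2 * (n : ℝ) ^ 2)]
  refine cauchySeq_tendsto_of_complete (Metric.cauchySeq_iff'.mpr fun ε hε => ?_)
  have hlim : Tendsto (fun n : ℕ => 2 * (C / (n : ℝ) ^ 2)) atTop (𝓝 0) := by
    have := (tendsto_pow_atTop (α := ℝ) two_ne_zero).comp tendsto_natCast_atTop_atTop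
    simpa using (this.const_div_atTop C).const_mul 2
  obtain ⟨N, hN, hN0⟩ := ((hlim.eventually_lt_const hε).and (eventually_gt_atTop 0)).exists
  refine ⟨N, fun n hn => ?_⟩
  -- compare both terms with the one at `n * N`
  have h1 := hmul n N (hN0.trans_le hn) hN0
  have h2 := hmul N n hN0 (hN0.trans_le hn)
  rw [mul_comm N n] at h2
  have h3 : C / (n : ℝ) ^ 2 ≤ C / (N : ℝ) ^ 2 := by
    have : (0 : ℝ) < N := by exact_mod_cast hN0
    gcongr
  rw [Real.dist_eq]
  rw [abs_le] at h1 h2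
  rw [abs_lt]
  constructor <;> linarith

/-- If moreover `a (2 n) ≥ 4 a n`, then the limit is at least `a 1`. -/
lemma le_of_tendsto_div_sq {a : ℕ → ℝ} {l : ℝ} (h : ∀ n, 4 * a n ≤ a (2 * n))
    (hl : Tendsto (fun n : ℕ => a n / (n : ℝ) ^ 2) atTop (𝓝 l)) : a 1 ≤ l := by
  have hk (k : ℕ) : a 1 * 4 ^ k ≤ a (2 ^ k) := by
    induction k with
    | zero => simp
    | succ k ih =>
      have := h (2 ^ k)
      rw [pow_succ' 2 k, pow_succ]
      linarith
  refine ge_of_tendsto' (hl.comp (tendsto_pow_atTop_atTop_of_one_lt one_lt_two)) fun k => ?_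
  simp only [Function.comp_apply, Nat.cast_pow, Nat.cast_ofNat]
  rw [← pow_mul, mul_comm k 2, pow_mul, le_div_iff₀ (by positivity)]
  norm_num
  exact hk k

/-! ### Descent for `r⁴ - 3 r² e² + e⁴ = s²` -/

/-- A solution of the system `x² - y² = z²`, `x² + 4 y² = w²` with `x` odd and coprime to `y`
comes from a solution of the quartic equation `u⁴ - 3 u² v² + v⁴ = z²` with `u v = y`, by the
classification of the Pythagorean triple `(x, 2 y, w)`. -/
lemma exists_quartic_of_system {x y z w : ℤ} (hxy : IsCoprime x y) (hx : x % 2 = 1)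
    (h₁ : x ^ 2 - y ^ 2 = z ^ 2) (h₂ : x ^ 2 + 4 * y ^ 2 = w ^ 2) :
    ∃ u v : ℤ, IsCoprime u v ∧ u * v = y ∧ u ^ 4 - 3 * u ^ 2 * v ^ 2 + v ^ 4 = z ^ 2 := by
  have hx0 : x ≠ 0 := by rintro rfl; simp at hx
  have hw : w ≠ 0 := by
    rintro rfl
    have : 0 < x ^ 2 := by positivity
    nlinarith [sq_nonneg y]
  have hpy : PythagoreanTriple x (2 * y) |w| := by
    unfold PythagoreanTriple
    rw [abs_mul_abs_self]
    linear_combination h₂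
  have hx2 : IsCoprime x 2 := ⟨1, -(x / 2), by omega⟩
  obtain ⟨u, v, hu, hv, -, hc, -, -⟩ := hpy.coprime_classification'
    (Int.isCoprime_iff_gcd_eq_one.mp (hx2.mul_right hxy)) hx (abs_pos.mpr hw)
  have huv : u * v = y := by linarith
  refine ⟨u, v, Int.isCoprime_iff_gcd_eq_one.mpr hc, huv, ?_⟩
  rw [← h₁, hu, ← huv]
  ring

/-- The descent step: from a coprime solution with `e` even to a smaller one. It starts from the
Pythagorean triple `s² + (r e)² = (r² - e²)²`. -/
lemma exists_smaller_quartic {r e s : ℤ} (hre : IsCoprime r e) (hr : r % 2 = 1) (he : e % 2 = 0)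
    (he0 : e ≠ 0) (h : r ^ 4 - 3 * r ^ 2 * e ^ 2 + e ^ 4 = s ^ 2) :
    ∃ u v t : ℤ, IsCoprime u v ∧ u * v ≠ 0 ∧ (u * v).natAbs < (r * e).natAbs ∧
      u ^ 4 - 3 * u ^ 2 * v ^ 2 + v ^ 4 = t ^ 2 := by
  have hr0 : r ≠ 0 := by rintro rfl; simp at hr
  have hr2 : r ^ 2 % 4 = 1 := by
    obtain ⟨k, hk⟩ : ∃ k, r = 2 * k + 1 := ⟨r / 2, by omega⟩
    rw [hk, show (2 * k + 1) ^ 2 = 4 * (k ^ 2 + k) + 1 by ring]; omega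
  have he2 : e ^ 2 % 4 = 0 := by
    obtain ⟨k, hk⟩ : ∃ k, e = 2 * k := ⟨e / 2, by omega⟩
    rw [hk, show (2 * k) ^ 2 = 4 * k ^ 2 by ring]; omega
  have hs : s % 2 = 1 := by
    by_contra hs
    obtain ⟨k, rfl⟩ : ∃ k, s = 2 * k := ⟨s / 2, by omega⟩
    obtain ⟨i, hi⟩ : ∃ i, r ^ 2 = 4 * i + 1 := ⟨r ^ 2 / 4, by omega⟩
    obtain ⟨j, hj⟩ : ∃ j, e ^ 2 = 4 * j := ⟨e ^ 2 / 4, by omega⟩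
    have : (4 * i + 1) ^ 2 - 3 * (4 * i + 1) * (4 * j) + (4 * j) ^ 2 = (2 * k) ^ 2 := by
      rw [← hi, ← hj, ← h]; ring
    ring_nf at this
    omega
  have hpy : PythagoreanTriple s (r * e) |r ^ 2 - e ^ 2| := by
    unfold PythagoreanTriple
    rw [abs_mul_abs_self]
    linear_combination -h
  have hcop : IsCoprime s (r * e) := by
    have h1 : IsCoprime r (r ^ 2 - e ^ 2) := by
      have : IsCoprime r (-e ^ 2 + r * r) := (hre.pow_right.neg_right).add_mul_left_right r
      convert this using 1; ring
    have h2 : IsCoprime e (r ^ 2 - e ^ 2) := by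
      have : IsCoprime e (r ^ 2 + e * (-e)) := (hre.symm.pow_right).add_mul_left_right (-e)
      convert this using 1; ring
    have h3 : IsCoprime (r * e) ((r ^ 2 - e ^ 2) ^ 2) := (h1.mul_left h2).pow_right
    have h4 : IsCoprime (r * e) (s ^ 2) := by
      rw [show s ^ 2 = (r ^ 2 - e ^ 2) ^ 2 + r * e * (-(r * e)) by linear_combination -h]
      exact h3.add_mul_left_right _
    exact ((IsCoprime.pow_right_iff two_pos).mp h4).symm
  have hne : r ^ 2 - e ^ 2 ≠ 0 := by omega
  obtain ⟨m, n, -, hmn, hz, -, hpar, -⟩ := hpy.coprime_classification'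
    (Int.isCoprime_iff_gcd_eq_one.mp hcop) hs (abs_pos.mpr hne)
  -- `m² + n² ≡ 1 ≡ r² - e²` modulo 4 determines the sign
  have hz' : r ^ 2 - e ^ 2 = m ^ 2 + n ^ 2 := by
    have hmn4 : (m ^ 2 + n ^ 2) % 4 = 1 := by
      rcases hpar with ⟨h1, h2⟩ | ⟨h1, h2⟩
      · obtain ⟨i, rfl⟩ : ∃ i, m = 2 * i := ⟨m / 2, by omega⟩
        obtain ⟨j, rfl⟩ : ∃ j, n = 2 * j + 1 := ⟨n / 2, by omega⟩
        ring_nf; omega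
      · obtain ⟨i, rfl⟩ : ∃ i, m = 2 * i + 1 := ⟨m / 2, by omega⟩
        obtain ⟨j, rfl⟩ : ∃ j, n = 2 * j := ⟨n / 2, by omega⟩
        ring_nf; omega
    rcases abs_choice (r ^ 2 - e ^ 2) with h | h <;> rw [h] at hz <;> omega
  have hrmn : r ∣ m * n := by
    have hr2 : IsCoprime r 2 := ⟨1, -(r / 2), by omega⟩
    refine hr2.dvd_of_dvd_mul_left (y := 2) ?_
    exact ⟨e, by linarith⟩
  obtain ⟨α, β, ⟨γ, rfl⟩, ⟨δ, rfl⟩, rfl⟩ := exists_dvd_and_dvd_of_dvd_mul hrmn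
  have hα : α ≠ 0 := left_ne_zero_of_mul hr0
  have hβ : β ≠ 0 := right_ne_zero_of_mul hr0
  obtain rfl : e = 2 * γ * δ := by
    apply mul_left_cancel₀ hr0
    linear_combination hmn
  have hγ : γ ≠ 0 := by rintro rfl; simp at he0
  have hδ : δ ≠ 0 := by rintro rfl; simp at he0
  have hαδ : IsCoprime α δ := hre.of_mul_left_left.of_mul_right_right
  have hβγ : IsCoprime β γ := hre.of_mul_left_right.of_mul_right_left.of_mul_right_right
  have key : α ^ 2 * (β ^ 2 - γ ^ 2) = δ ^ 2 * (β ^ 2 + 4 * γ ^ 2) := by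
    linear_combination hz'
  obtain ⟨k, hk⟩ : δ ^ 2 ∣ β ^ 2 - γ ^ 2 :=
    (hαδ.symm.pow (m := 2) (n := 2)).dvd_of_dvd_mul_left ⟨_, key⟩
  have hk' : β ^ 2 + 4 * γ ^ 2 = k * α ^ 2 := by
    apply mul_left_cancel₀ (pow_ne_zero 2 hδ)
    rw [← key, hk]; ring
  -- `k` divides `5 β²` and `5 γ²`, so `k = 1` or `k = 5`; both lead back to the quartic, with
  -- the roles of `(β, γ)` and `(α, δ)` exchanged
  have hkpos : 0 < k := by
    have h1 : 0 < k * α ^ 2 := by rw [← hk']; positivity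
    exact pos_of_mul_pos_left h1 (sq_nonneg α)
  have hk5 : k ∣ 5 := by
    obtain ⟨p, q, hpq⟩ := hβγ.pow (m := 2) (n := 2)
    refine ⟨p * (4 * δ ^ 2 + α ^ 2) + q * (α ^ 2 - δ ^ 2), ?_⟩
    linear_combination (-5) * hpq + (4 * p - q) * hk + (p + q) * hk'
  have hodd : α % 2 = 1 ∧ β % 2 = 1 := by
    rw [← Int.odd_iff, Int.odd_mul, Int.odd_iff, Int.odd_iff] at hr
    exact hr
  have hsize (y c : ℤ) (hy : y ≠ 0) (hc : c ≠ 0) : y.natAbs < (2 * c * y).natAbs := by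
    rw [Int.natAbs_mul, Int.natAbs_mul]
    have := Int.natAbs_pos.mpr hy
    have := Int.natAbs_pos.mpr hc
    simp only [Int.reduceAbs]
    nlinarith
  have hcases : k = 1 ∨ k = 5 := by
    have := Int.le_of_dvd (by norm_num) hk5
    interval_cases k <;> omega
  rcases hcases with rfl | rfl
  · obtain ⟨u, v, huv, rfl, huv'⟩ := exists_quartic_of_system (z := δ) (w := α) hβγ hodd.2
      (by linarith) (by linarith)
    refine ⟨u, v, δ, huv, hγ, ?_, huv'⟩
    rw [show α * β * (2 * (u * v) * δ) = 2 * (α * β * δ) * (u * v) by ring]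
    exact hsize _ _ hγ (mul_ne_zero hr0 hδ)
  · obtain ⟨u, v, huv, rfl, huv'⟩ := exists_quartic_of_system (z := γ) (w := β) hαδ hodd.1
      (by linarith) (by linarith)
    refine ⟨u, v, γ, huv, hδ, ?_, huv'⟩
    rw [show α * β * (2 * γ * (u * v)) = 2 * (α * β * γ) * (u * v) by ring]
    exact hsize _ _ hδ (mul_ne_zero hr0 hγ)

/-- Fermat descent: `r⁴ - 3 r² e² + e⁴` is never a square for coprime nonzero `r`, `e`. -/
theorem quartic_ne_sq (r e s : ℤ) (hre : IsCoprime r e) (h0 : r * e ≠ 0) :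
    r ^ 4 - 3 * r ^ 2 * e ^ 2 + e ^ 4 ≠ s ^ 2 := by
  induction hn : (r * e).natAbs using Nat.strong_induction_on generalizing r e s with
  | _ n ih =>
    intro h
    subst hn
    have hr0 := left_ne_zero_of_mul h0
    have he0 := right_ne_zero_of_mul h0
    rcases Int.emod_two_eq_zero_or_one r with hr | hr <;>
      rcases Int.emod_two_eq_zero_or_one e with he | he
    · have := hre.isUnit_of_dvd' (Int.dvd_of_emod_eq_zero hr) (Int.dvd_of_emod_eq_zero he)
      norm_num [Int.isUnit_iff] at this
    · obtain ⟨u, v, t, huv, h1, h2, h3⟩ := exists_smaller_quartic hre.symm he hr hr0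
        (s := s) (by rw [← h]; ring)
      exact ih _ (by rwa [mul_comm r e]) u v t huv h1 rfl h3
    · obtain ⟨u, v, t, huv, h1, h2, h3⟩ := exists_smaller_quartic hre hr he he0 h
      exact ih _ h2 u v t huv h1 rfl h3
    · obtain ⟨i, rfl⟩ : ∃ i, r = 2 * i + 1 := ⟨r / 2, by omega⟩
      obtain ⟨j, rfl⟩ : ∃ j, e = 2 * j + 1 := ⟨e / 2, by omega⟩
      rcases Int.even_or_odd' s with ⟨k, rfl | rfl⟩ <;> ring_nf at h <;> omega

/-- On `y² = x³ - 2 x - 1`, where the real inequality fails for some `-1 < x < 0`, there is no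
rational point with such an abscissa: `x + 1` would be a square `r² / e²`, and
`r⁴ - 3 r² e² + e⁴` a square as well. -/
theorem nonneg_of_neg_one_lt {x y : ℚ} (hxy : y ^ 2 = x ^ 3 - 2 * x - 1) (hx : -1 < x) :
    0 ≤ x := by
  by_contra! hx0
  obtain ⟨X, rfl⟩ : ∃ X, x = X - 1 := ⟨x + 1, by ring⟩
  have hX : 0 < X := by linarith
  have hy : y ^ 2 = X * (X ^ 2 - 3 * X + 1) := by rw [hxy]; ring
  have hu : 0 < X.num := Rat.num_pos.mpr hX
  have hd : (X.den : ℚ) ≠ 0 := by exact_mod_cast X.den_nz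
  have hcop : IsCoprime X.num X.den := Rat.isCoprime_num_den X
  -- clear denominators: `num * den * (num² - 3 num den + den²)` is the square of `y * den²`
  have hsq : (y * X.den ^ 2) ^ 2 =
      ((X.num * X.den * (X.num ^ 2 - 3 * X.num * X.den + X.den ^ 2) : ℤ) : ℚ) := by
    push_cast
    rw [← Rat.mul_den_eq_num X, mul_pow, hy]
    ring
  obtain ⟨w, hw⟩ : ∃ w : ℤ,
      w ^ 2 = X.num * X.den * (X.num ^ 2 - 3 * X.num * X.den + X.den ^ 2) := by
    have h : IsSquare ((X.num * X.den * (X.num ^ 2 - 3 * X.num * X.den + X.den ^ 2) : ℤ) : ℚ) :=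
      ⟨_, by rw [← hsq, sq]⟩
    rw [Rat.isSquare_intCast_iff] at h
    obtain ⟨w, hw⟩ := h
    exact ⟨w, by rw [hw, sq]⟩
  have hd0 : (0 : ℤ) < X.den := by exact_mod_cast X.den_pos
  generalize X.num = u at *
  generalize (X.den : ℤ) = d at *
  have hc1 : IsCoprime u (u ^ 2 - 3 * u * d + d ^ 2) := by
    rw [show u ^ 2 - 3 * u * d + d ^ 2 = d ^ 2 + u * (u - 3 * d) by ring]
    exact hcop.pow_right.add_mul_left_right _
  have hc2 : IsCoprime d (u ^ 2 - 3 * u * d + d ^ 2) := by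
    rw [show u ^ 2 - 3 * u * d + d ^ 2 = u ^ 2 + d * (d - 3 * u) by ring]
    exact hcop.symm.pow_right.add_mul_left_right _
  obtain ⟨r, hr⟩ := Int.sq_of_isCoprime (hcop.mul_right hc1)
    (show u * (d * (u ^ 2 - 3 * u * d + d ^ 2)) = w ^ 2 by rw [hw]; ring)
  obtain ⟨e, he⟩ := Int.sq_of_isCoprime (hcop.symm.mul_right hc2)
    (show d * (u * (u ^ 2 - 3 * u * d + d ^ 2)) = w ^ 2 by rw [hw]; ring)
  obtain ⟨s, hs⟩ := Int.sq_of_isCoprime (hc1.mul_left hc2).symm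
    (show (u ^ 2 - 3 * u * d + d ^ 2) * (u * d) = w ^ 2 by rw [hw]; ring)
  replace hr : u = r ^ 2 := hr.resolve_right fun h => by nlinarith [sq_nonneg r]
  replace he : d = e ^ 2 := he.resolve_right fun h => by nlinarith [sq_nonneg e]
  have hw0 : 0 ≤ u ^ 2 - 3 * u * d + d ^ 2 := by
    have h := sq_nonneg w
    rw [hw] at h
    exact nonneg_of_mul_nonneg_right h (mul_pos hu hd0)
  replace hs : u ^ 2 - 3 * u * d + d ^ 2 = s ^ 2 := hs.elim id fun h => by nlinarith [sq_nonneg s]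
  refine quartic_ne_sq r e s ?_ ?_ ?_
  · rw [hr, he] at hcop
    exact (IsCoprime.pow_iff two_pos two_pos).mp hcop
  · rintro h
    rcases mul_eq_zero.mp h with rfl | rfl
    · simp [hr] at hu
    · simp [he] at hd0
  · rw [← hs, hr, he]; ring

/-! ### The real inequality -/

/-- If the sign condition holds on the real locus and `b > 0`, then `8 b² ≤ |a|³`: otherwise the
vertex `2 b / |a|` of the quadratic lies on the real locus, and the quadratic is positive there. -/
lemma cubic_disc_bound {a b : ℤ} (ha : a < 0) (hb : 0 < b)
    (hq : ∀ x : ℝ, 0 ≤ x ^ 3 + a * x + b → 2 * (a : ℝ) * x ^ 2 + 8 * b * x - (a : ℝ) ^ 2 ≤ 0) :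
    8 * b ^ 2 ≤ (-a) ^ 3 := by
  by_contra! h
  have ha' : (0 : ℝ) < -a := by exact_mod_cast neg_pos.mpr ha
  have hb' : (0 : ℝ) < b := by exact_mod_cast hb
  have h' : ((-a : ℝ)) ^ 3 < 8 * (b : ℝ) ^ 2 := by exact_mod_cast h
  obtain ⟨t, ht⟩ : ∃ t : ℝ, t = 2 * b / (-a) := ⟨_, rfl⟩
  have hta : t * (-a) = 2 * b := by rw [ht, div_mul_cancel₀ _ ha'.ne']
  have htpos : 0 < t := by rw [ht]; positivity
  -- the vertex of the quadratic lies on the real locus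
  have h1 : (-a : ℝ) < 2 * t ^ 2 := by
    have : (-a : ℝ) ^ 2 * (-a) < (-a : ℝ) ^ 2 * (2 * t ^ 2) := by
      have : (-a : ℝ) ^ 2 * (2 * t ^ 2) = 2 * (t * (-a)) ^ 2 := by ring
      rw [this, hta]; nlinarith
    exact lt_of_mul_lt_mul_left this (by positivity)
  have h2 := hq t (by nlinarith)
  have h3 : 4 * t * (t * (-a)) = 4 * t * (2 * b) := by rw [hta]
  nlinarith

/-- The real inequality behind `h_W(2P) ≥ 4 h_W(P)`: the numerator and the denominator of the
duplication map are not both small. The excluded cases `(a, b) = (-2, ±1)` are genuine exceptions. -/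
theorem max_pow_four_le_max_duplication {a b : ℤ} (ha : a ≤ 0) (hΔ : 4 * a ^ 3 + 27 * b ^ 2 ≠ 0)
    (hq : ∀ x : ℝ, 0 ≤ x ^ 3 + a * x + b → 2 * (a : ℝ) * x ^ 2 + 8 * b * x - (a : ℝ) ^ 2 ≤ 0)
    (hex : ¬ (a = -2 ∧ b = 1)) {x : ℝ} (hx : 0 ≤ x ^ 3 + a * x + b)
    (hex' : a = -2 → b = -1 → -1 < x → 0 ≤ x) :
    max |x| 1 ^ 4 ≤
      max |x ^ 4 - 2 * a * x ^ 2 - 8 * b * x + (a : ℝ) ^ 2| |4 * (x ^ 3 + a * x + b)| := by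
  have hqx := hq x hx
  rcases le_or_gt 1 |x| with h1 | h1
  · rw [max_eq_left h1, Even.pow_abs (by decide)]
    refine le_max_of_le_left (le_trans ?_ (le_abs_self _))
    linarith
  rw [max_eq_right h1.le, one_pow]
  by_contra! hlt
  obtain ⟨hf, hg⟩ := max_lt_iff.mp hlt
  replace hf := (abs_lt.mp hf).2
  replace hg := (abs_lt.mp hg).2
  obtain ⟨hx1, hx2⟩ := abs_lt.mp h1
  -- for `a = 0` the sign condition forces `b ≤ -1`, so that the real locus lies in `x ≥ 1`
  have ha0 : a ≠ 0 := by
    rintro rfl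
    have hb : (b : ℝ) ≤ 0 := by
      have := hq (max 1 (-(b : ℝ))) ?_
      · have h0 : (0 : ℝ) < max 1 (-(b : ℝ)) := lt_of_lt_of_le one_pos (le_max_left _ _)
        simp only [Int.cast_zero] at this
        nlinarith
      · have h0 : (1 : ℝ) ≤ max 1 (-(b : ℝ)) := le_max_left _ _
        have h2 : (-b : ℝ) ≤ max 1 (-(b : ℝ)) := le_max_right _ _
        simp only [Int.cast_zero, zero_mul, add_zero]
        nlinarith [mul_le_mul h0 h0 zero_le_one (by linarith : (0 : ℝ) ≤ max 1 (-(b : ℝ))),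
          pow_le_pow_right₀ h0 (show 1 ≤ 3 by norm_num)]
    have hb' : b ≤ 0 := by exact_mod_cast hb
    have hb1 : (b : ℝ) ≤ -1 := by
      have : b ≠ 0 := by rintro rfl; simp at hΔ
      exact_mod_cast (show b ≤ -1 by omega)
    simp only [Int.cast_zero, zero_mul, add_zero] at hx
    nlinarith [sq_nonneg x, sq_nonneg (x + 1)]
  have ha1 : a ≤ -1 := by omega
  have haR : (a : ℝ) ≤ -1 := by exact_mod_cast ha1
  -- for `b x ≤ 0` already the numerator is at least `a² ≥ 1`
  have hbx : 0 < b * x := by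
    by_contra! h
    nlinarith [sq_nonneg x, sq_nonneg (x ^ 2), mul_nonneg (sq_nonneg x) (by linarith : 0 ≤ -(a : ℝ))]
  have hid : x ^ 4 - 2 * a * x ^ 2 - 8 * b * x + (a : ℝ) ^ 2 =
      (3 * x ^ 2 + a) ^ 2 - 2 * x * (4 * (x ^ 3 + a * x + b)) := by ring
  have hxsq : x ^ 2 < 1 := by nlinarith
  rcases lt_or_ge 0 x with hpos | hneg
  · have hb : 0 < b := by
      have : (0 : ℝ) < b := by nlinarith
      exact_mod_cast this
    have hdisc := cubic_disc_bound (by omega) hb hq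
    have ha4 : -4 ≤ a := by
      by_contra! h
      have : (a : ℝ) ≤ -5 := by exact_mod_cast (show a ≤ -5 by omega)
      have h4 : 4 < (3 * x ^ 2 + a) ^ 2 := by nlinarith
      rw [hid] at hf
      nlinarith
    have hb2 : b ≤ 2 := by
      have : (-a) ^ 3 ≤ 4 ^ 3 := pow_le_pow_left₀ (by omega) (by omega) 3
      nlinarith
    interval_cases a <;> interval_cases b <;> 
      first
        | (norm_num at hdisc; done)
        | (norm_num at hex; done)
        | (norm_num at hf; nlinarith [sq_nonneg (x - 1), sq_nonneg (3 * x - 2), sq_nonneg (x ^ 2)])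
  · have hx0 : x < 0 := lt_of_le_of_ne hneg (by rintro rfl; simp at hbx)
    have hb : b < 0 := by
      have : (b : ℝ) < 0 := by nlinarith
      exact_mod_cast this
    have ha3 : -3 ≤ a := by
      by_contra! h
      have : (a : ℝ) ≤ -4 := by exact_mod_cast (show a ≤ -4 by omega)
      have h4 : 1 < (3 * x ^ 2 + a) ^ 2 := by nlinarith
      rw [hid] at hf
      nlinarith
    have hbl : -2 ≤ b := by
      have haR3 : (-3 : ℝ) ≤ a := by exact_mod_cast ha3
      have : (-3 : ℝ) < b := by
        nlinarith [pow_pos (neg_pos.mpr hx0) 3]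
      have : -3 < b := by exact_mod_cast this
      omega
    have hx3 : x ^ 3 < 0 := Odd.pow_neg (by decide) hx0
    interval_cases a <;> interval_cases b <;>
      first
        | (norm_num at hΔ; done)
        | (norm_num at hx; linarith)
        | (norm_num at hex'; linarith [hex' hx1])
        | (norm_num at hf; nlinarith [sq_nonneg (3 * x + 2), sq_nonneg (x ^ 2)])

/-! ### Comparison of the heights -/

/-- Duplication multiplies the Weil height by at least `4`. -/
theorem four_mul_weilHeight_le {a b : ℤ} (hE : (curve a b).Δ ≠ 0)
    (hc : ∀ (p : ℕ) [Fact p.Prime], (p : ℤ) ∣ (curve a b).Δ → tamagawaNumber a b p = 1)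
    (ha : a ≤ 0)
    (hq : ∀ x : ℝ, 0 ≤ x ^ 3 + a * x + b → 2 * (a : ℝ) * x ^ 2 + 8 * b * x - (a : ℝ) ^ 2 ≤ 0)
    (P : Pt a b ℚ) : 4 * weilHeight P ≤ weilHeight (P + P) := by
  rcases P with _ | ⟨x, y, h⟩
  · rw [← Affine.Point.zero_def, add_zero, weilHeight_zero, mul_zero]
  have hxy := curve_equation_iff.mp h.1
  have hcop := coprime_dupNum_dupDen hE hc hxy
  have hd : (0 : ℝ) < x.den := by exact_mod_cast x.den_pos
  have hdq : (0 : ℚ) < x.den := by exact_mod_cast x.den_pos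
  have hnum : (x.num : ℝ) = x * x.den := by
    exact_mod_cast congrArg (Rat.cast : ℚ → ℝ) (Rat.mul_den_eq_num x).symm
  have hnumq : (x.num : ℚ) = x * x.den := (Rat.mul_den_eq_num x).symm
  -- the height of the double is read off from the numerator and denominator, in lowest terms
  have hdouble : weilHeight (.some x y h + .some x y h : Pt a b ℚ) =
      Real.log (max |(dupNum a b x.num x.den : ℝ)| |(dupDen a b x.num x.den : ℝ)|) := by
    have hG : (dupDen a b x.num x.den : ℚ) = x.den ^ 4 * (4 * y ^ 2) := by
      rw [hxy]
      simp only [dupDen]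
      push_cast
      rw [hnumq]; ring
    have hF : (dupNum a b x.num x.den : ℚ) =
        x.den ^ 4 * (x ^ 4 - 2 * a * x ^ 2 - 8 * b * x + a ^ 2) := by
      simp only [dupNum]
      push_cast
      rw [hnumq]; ring
    by_cases hy : y = 0
    · have hG0 : dupDen a b x.num x.den = 0 := by
        rw [hy] at hG
        exact_mod_cast hG.trans (by ring : _ = (0 : ℚ))
      rw [hG0, Int.natAbs_zero, Nat.coprime_zero_right] at hcop
      rw [add_self_eq_zero h hy, hG0, ← Int.cast_abs, Int.abs_eq_natAbs, hcop]
      simp [weilHeight_zero]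
    · have hGpos : 0 < dupDen a b x.num x.den := by
        have : (0 : ℚ) < dupDen a b x.num x.den := by rw [hG]; positivity
        exact_mod_cast this
      have hx2 : (.some x y h + .some x y h : Pt a b ℚ).xRep =
          ![(dupNum a b x.num x.den : ℚ) / dupDen a b x.num x.den, 1] := by
        rw [xRep_add_self h hy, hF, hG, mul_div_mul_left _ _ (by positivity), hxy]
      rw [← logHeight_xRep, hx2, ← Height.logHeight₁_eq_logHeight, Rat.logHeight₁_eq_log_max,
        Rat.num_div_eq_of_coprime hGpos hcop]
      have hden : ((dupNum a b x.num x.den / dupDen a b x.num x.den : ℚ).den : ℝ) =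
          |(dupDen a b x.num x.den : ℝ)| := by
        rw [abs_of_pos (by exact_mod_cast hGpos)]
        exact_mod_cast Rat.den_div_eq_of_coprime hGpos hcop
      rw [Nat.cast_max, hden, Nat.cast_natAbs, Int.cast_abs]
  rw [hdouble]
  simp only [weilHeight]
  have hmax : max |(x.num : ℝ)| (x.den : ℝ) = x.den * max |(x : ℝ)| 1 := by
    rw [hnum, abs_mul, abs_of_pos hd, mul_max_of_nonneg _ _ hd.le, mul_one, mul_comm]
  have hpos : 0 < max |(x : ℝ)| 1 := lt_max_of_lt_right one_pos
  rw [hmax, ← Nat.cast_ofNat (n := 4), ← Real.log_pow]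
  refine Real.log_le_log (by positivity) ?_
  have hxyR : (y : ℝ) ^ 2 = (x : ℝ) ^ 3 + a * x + b := by exact_mod_cast hxy
  have key := max_pow_four_le_max_duplication (x := x) ha ?_ hq ?_ (hxyR ▸ sq_nonneg _) ?_
  · rw [mul_pow]
    have hG : (dupDen a b x.num x.den : ℝ) = x.den ^ 4 * (4 * ((x : ℝ) ^ 3 + a * x + b)) := by
      simp only [dupDen]
      push_cast
      rw [hnum]; ring
    have hF : (dupNum a b x.num x.den : ℝ) =
        x.den ^ 4 * ((x : ℝ) ^ 4 - 2 * a * x ^ 2 - 8 * b * x + (a : ℝ) ^ 2) := by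
      simp only [dupNum]
      push_cast
      rw [hnum]; ring
    have hd4 : (0 : ℝ) < (x.den : ℝ) ^ 4 := by positivity
    rw [hF, hG, abs_mul, abs_mul _ (4 * _), abs_of_pos hd4, ← mul_max_of_nonneg _ _ hd4.le]
    exact mul_le_mul_of_nonneg_left key hd4.le
  · intro h0
    exact hE (by rw [curve_Δ, h0, mul_zero])
  · rintro ⟨rfl, rfl⟩
    refine tamagawaNumber_neg_two_one_ne_one (hc 2 ?_)
    rw [curve_Δ]; norm_num
  · rintro rfl rfl hx
    have hx' : (-1 : ℚ) < x := by exact_mod_cast hx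
    exact_mod_cast nonneg_of_neg_one_lt (by rw [hxy]; push_cast; ring) hx'

/-- The common part of both cases: the sign condition on the whole real locus suffices. -/
theorem heightConclusion_of_nonpos {a b : ℤ} (hE : (curve a b).Δ ≠ 0)
    (hc : ∀ (p : ℕ) [Fact p.Prime], (p : ℤ) ∣ (curve a b).Δ → tamagawaNumber a b p = 1)
    (ha : a ≤ 0)
    (hq : ∀ x : ℝ, 0 ≤ x ^ 3 + a * x + b → 2 * (a : ℝ) * x ^ 2 + 8 * b * x - (a : ℝ) ^ 2 ≤ 0) :
    HeightConclusion a b := by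
  obtain ⟨C, hC⟩ := exists_parallelogram_bound hE
  have hheight (P : Pt a b ℚ) : Tendsto (heightSeq P) atTop (𝓝 (canonicalHeight P)) ∧
      1 / 2 * weilHeight P ≤ canonicalHeight P := by
    obtain ⟨l, hl⟩ := exists_tendsto_div_sq (a := fun n => weilHeight (n • P)) (C := C)
      (by simp [weilHeight_zero]) fun m n hnm => by
        simpa only [add_smul, sub_nsmul _ hnm, ← sub_eq_add_neg] using hC (m • P) (n • P)
    have hle := le_of_tendsto_div_sq (fun n => by
      simpa only [mul_smul, two_smul] using four_mul_weilHeight_le hE hc ha hq (n • P)) hl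
    have hseq : Tendsto (heightSeq P) atTop (𝓝 (1 / 2 * l)) := hl.const_mul _
    have hcan : canonicalHeight P = 1 / 2 * l := hseq.limUnder_eq
    rw [hcan]
    refine ⟨hseq, ?_⟩
    rw [one_smul] at hle
    linarith
  have hzero : canonicalHeight (0 : Pt a b ℚ) = 0 := by
    refine Tendsto.limUnder_eq (tendsto_const_nhds.congr fun n => ?_)
    simp [heightSeq, weilHeight_zero]
  have hgreatest : IsGreatest (heightDifferences a b) 0 := by
    refine ⟨⟨0, ?_⟩, ?_⟩
    · simp only [hzero]
      simp [weilHeight_zero]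
    · rintro _ ⟨P, rfl⟩
      exact sub_nonpos.mpr (hheight P).2
  have hdelta : delta a b = 0 := hgreatest.csSup_eq
  exact ⟨hheight, hdelta.symm ▸ hgreatest, hdelta⟩

/-! ### The sign condition on the real locus -/

/-- The strict sign condition extends to a weak one on closures. -/
lemma nonpos_of_mem_closure_negSet {a b : ℤ} {x : ℝ} (h : x ∈ closure (negSet a b)) :
    2 * (a : ℝ) * x ^ 2 + 8 * b * x - (a : ℝ) ^ 2 ≤ 0 := by
  have hcl : IsClosed {x : ℝ | 2 * (a : ℝ) * x ^ 2 + 8 * b * x - (a : ℝ) ^ 2 ≤ 0} :=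
    isClosed_le (by fun_prop) (by fun_prop)
  have hsub : negSet a b ⊆ {x : ℝ | 2 * (a : ℝ) * x ^ 2 + 8 * b * x - (a : ℝ) ^ 2 ≤ 0} :=
    fun x hx => by
      simp only [negSet, Set.mem_ofPred_eq] at hx ⊢
      exact hx.le
  exact closure_minimal hsub hcl h

/-- If `E(ℝ)` is connected, the real locus lies to the right of any root of the cubic: otherwise
the cubic would be nonnegative on both sides of that root, which would then be a double root. -/
lemma le_of_isRealRoot {a b : ℤ} (hE : (curve a b).Δ ≠ 0) (hconn : numRealComponents a b = 1)
    {α x : ℝ} (hα : IsRealRoot a b α) (hx : 0 ≤ x ^ 3 + a * x + b) : α ≤ x := by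
  by_contra! hlt
  unfold IsRealRoot at hα
  have hmin : IsLocalMin (fun t : ℝ => t ^ 3 + a * t + b) α := by
    filter_upwards [lt_mem_nhds hlt] with t ht
    rw [hα]
    exact cubic_nonneg_of_numRealComponents_eq_one hE hconn ht hx
  have hder : HasDerivAt (fun t : ℝ => t ^ 3 + a * t + b) (3 * α ^ 2 + a) α := by
    simpa using ((hasDerivAt_pow 3 α).add ((hasDerivAt_id α).const_mul (a : ℝ))).add_const (b : ℝ)
  have h0 := hmin.hasDerivAt_eq_zero hder
  apply hE
  rw [curve_Δ]
  have ha : (a : ℝ) = -3 * α ^ 2 := by linarith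
  have hb : (b : ℝ) = 2 * α ^ 3 := by rw [ha] at hα; linarith
  have : 4 * (a : ℝ) ^ 3 + 27 * (b : ℝ) ^ 2 = 0 := by rw [ha, hb]; ring
  rw [show 4 * a ^ 3 + 27 * b ^ 2 = 0 by exact_mod_cast this, mul_zero]

/-- If the cubic has three real roots, then it is nonnegative only between the smaller two and to
the right of the largest. -/
lemma mem_of_three_roots {a b : ℤ} {γ β α x : ℝ} (hγβ : γ < β) (hβα : β < α)
    (hγ : IsRealRoot a b γ) (hβ : IsRealRoot a b β) (hα : IsRealRoot a b α)
    (hx : 0 ≤ x ^ 3 + a * x + b) : x ∈ Set.Icc γ β ∪ Set.Ici α := by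
  unfold IsRealRoot at hγ hβ hα
  have h₁ : γ ^ 2 + γ * β + β ^ 2 + a = 0 := by
    apply (mul_eq_zero.mp _).resolve_left (sub_ne_zero.mpr hγβ.ne)
    linear_combination hγ - hβ
  have h₂ : β ^ 2 + β * α + α ^ 2 + a = 0 := by
    apply (mul_eq_zero.mp _).resolve_left (sub_ne_zero.mpr hβα.ne)
    linear_combination hβ - hα
  have hsum : γ + β + α = 0 := by
    apply (mul_eq_zero.mp _).resolve_left (sub_ne_zero.mpr (hγβ.trans hβα).ne)
    linear_combination h₁ - h₂
  have hfac : x ^ 3 + a * x + b = (x - γ) * (x - β) * (x - α) := by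
    linear_combination hα + (x - α) * h₂ + (x - α) * (x - β) * hsum
  rw [hfac] at hx
  by_contra! hnot
  simp only [Set.mem_union, Set.mem_Icc, Set.mem_Ici, not_or, not_and_or, not_le] at hnot
  obtain ⟨h | h, h'⟩ := hnot
  · have := mul_pos (mul_pos (sub_pos.mpr h) (sub_pos.mpr (h.trans hγβ))) (sub_pos.mpr h')
    linarith
  · have := mul_pos (mul_pos (sub_pos.mpr (hγβ.trans h)) (sub_pos.mpr h)) (sub_pos.mpr h')
    linarith

end EllHeight

theorem proposition1p3 (a₄ a₆ : ℤ)
    (hE : (EllHeight.curve a₄ a₆).Δ ≠ 0)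
    (hc : ∀ (p : ℕ) [Fact p.Prime], (p : ℤ) ∣ (EllHeight.curve a₄ a₆).Δ →
      EllHeight.tamagawaNumber a₄ a₆ p = 1)
    (ha₄ : a₄ ≤ 0) :
    (EllHeight.numRealComponents a₄ a₆ = 1 →
      ∀ α : ℝ, EllHeight.IsRealRoot a₄ a₆ α →
        Set.Ioi α ⊆ EllHeight.negSet a₄ a₆ →
        EllHeight.HeightConclusion a₄ a₆) ∧
    (EllHeight.numRealComponents a₄ a₆ = 2 →
      ∀ γ β α : ℝ, γ < β → β < α →
        EllHeight.IsRealRoot a₄ a₆ γ → EllHeight.IsRealRoot a₄ a₆ β →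
        EllHeight.IsRealRoot a₄ a₆ α →
        Set.Ioo γ β ∪ Set.Ioi α ⊆ EllHeight.negSet a₄ a₆ →
        EllHeight.HeightConclusion a₄ a₆) := by
  constructor
  · intro hconn α hα hsub
    refine EllHeight.heightConclusion_of_nonpos hE hc ha₄ fun x hx =>
      EllHeight.nonpos_of_mem_closure_negSet (closure_mono hsub ?_)
    rw [closure_Ioi]
    exact EllHeight.le_of_isRealRoot hE hconn hα hx
  · intro _ γ β α hγβ hβα hγ hβ hα hsub
    refine EllHeight.heightConclusion_of_nonpos hE hc ha₄ fun x hx =>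
      EllHeight.nonpos_of_mem_closure_negSet (closure_mono hsub ?_)
    rw [closure_union, closure_Ioo hγβ.ne, closure_Ioi]
    exact EllHeight.mem_of_three_roots hγβ hβα hγ hβ hα hx
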